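/- Conventions. $C^2(\mathbb R^p)$ is the space of twice continuously differentiable functions $\mathbb R^p\to\mathbb R$ with the topology of uniform convergence on compact sets of the functions and their first and second partial derivatives. An isolated point NaO ("not an object") is adjoined to $\mathbb R^p$ and to the space of $p\times p$ matrices; every operation with an argument NaO has the value NaO. The one-step Newton map is $$G(q,\delta)=\delta+\bigl(-\nabla^2q(\delta)\bigr)^{-1}\nabla q(\delta)$$ when $\delta\ne\mathrm{NaO}$ and $-\nabla^2 q(\delta)$ is positive definite, and $G(q,\delta)=\mathrm{NaO}$ otherwise. The infinite-step Newton map $G^\infty(q,\delta)$ is the limit of the iterates $\delta_0=\delta$, $\delta_k=G(q,\delta_{k-1})$ if this sequence converges, and NaO otherwise. A log likelihood of a family of distributions with almost surely positive densities $f_\theta$, $\theta\in\mathbb R^p$, with respect to some measure is a random function $l(\theta)=u(X)+\log f_\theta(X)$, where $X$ is the data and $u$ does not depend on $\theta$. A log likelihood $q(\delta)=\delta'Z-\tfrac12\delta'K\delta$, $\delta\in\mathbb R^p$, where $Z$ and $K$ are a random vector and a random symmetric matrix that are functions of the data, is that of an LAMN (locally asymptotically mixed normal) model if $K$ is almost surely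 positive definite and the distribution of $K$ does not depend on the parameter. Theorem. For each $n$ let $q_n$ be the log likelihood of a model with parameter space $\mathbb R^p$, a random element of $C^2(\mathbb R^p)$, the data having the distribution for the true parameter value zero, and let $\tilde\delta_n$ be a random element of $\mathbb R^p$ defined on the same probability space. Suppose $$(q_n,\tilde\delta_n)\xrightarrow{\ \mathcal L\ }(q,\tilde\delta)\qquad\text{in } C^2(\mathbb R^p)\times\mathbb R^p, \tag{0}$$ where $q(\delta)=\delta'Z-\tfrac12\delta'K\delta$ is the log likelihood of an LAMN model, under the true parameter value zero. Define $\hat\delta_n=G^\infty(q_n,\tilde\delta_n)$. Then \begin{align} -\nabla^2q_n(\tilde\delta_n)&\xrightarrow{\ \mathcal L\ }K, \tag{a}\\ -\nabla^2q_n(\hat\delta_n)&\xrightarrow{\ \mathcal L\ }K, \tag{b}\\ \hat\delta_n&\xrightarrow{\ \mathcal L\ }K^{-1}Z, \tag{c}\\ \bigl(-\nabla^2q_n(\hat\delta_n)\bigr)^{1/2}\hat\delta_n&\xrightarrow{\ \mathcal L\ }N(0,I), \tag{d} \end{align} where the square root in (d) is the symmetric square root when the matrix is positive definite and NaO otherwise.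 Moreover (0), (a), (b), (c) and (d) hold jointly, with joint limit $(q,\tilde\delta,K,K,K^{-1}Z,K^{-1/2}Z)$, in which $K^{-1/2}Z$ has the $N(0,I)$ distribution. -/

import Mathlib

open MeasureTheory ProbabilityTheory Filter Topology
open scoped MatrixOrder

noncomputable section

namespace NewtonMLE

/-- Euclidean space `ℝᵖ`. -/
abbrev Euc (p : ℕ) : Type := EuclideanSpace ℝ (Fin p)

/-- Real `p × p` matrices. -/
abbrev Mat (p : ℕ) : Type := Matrix (Fin p) (Fin p) ℝ

/-- Matrix times vector, `A v`, as a vector of Euclidean space. -/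
abbrev app {p : ℕ} (A : Mat p) (v : Euc p) : Euc p := Matrix.toEuclideanCLM (𝕜 := ℝ) A v

instance instMeasurableSpaceMat (p : ℕ) : MeasurableSpace (Mat p) :=
  inferInstanceAs (MeasurableSpace (Fin p → Fin p → ℝ))

instance instBorelSpaceMat (p : ℕ) : BorelSpace (Mat p) :=
  inferInstanceAs (BorelSpace (Fin p → Fin p → ℝ))

instance instSecondCountableMat (p : ℕ) : SecondCountableTopology (Mat p) :=
  inferInstanceAs (SecondCountableTopology (Fin p → Fin p → ℝ))

instance instSecondCountableEitherMat (p : ℕ) {β : Type*} [TopologicalSpace β] :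
    SecondCountableTopologyEither (Mat p) β := ⟨Or.inl inferInstance⟩

/-! ### Adjoining the isolated point NaO ("not an object") -/

/-- The disjoint topological (and measurable) union of `α` and the one-point space `{NaO}`;
`Sum.inl x` is the genuine value `x`. -/
abbrev WithNaO (α : Type*) : Type _ := α ⊕ Unit

/-- The adjoined isolated point. -/
abbrev NaO {α : Type*} : WithNaO α := Sum.inr ()

/-- The sum σ-algebra on `WithNaO α` is its Borel σ-algebra. -/
instance instBorelSpaceWithNaO {α : Type*} [TopologicalSpace α] [MeasurableSpace α]
    [BorelSpace α] : BorelSpace (WithNaO α) := by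
  refine ⟨le_antisymm ?_ ?_⟩
  · intro s hs
    have hs' := measurableSet_sum_iff.1 hs
    have h1 : @MeasurableSet _ (borel (WithNaO α)) (Sum.inl '' (Sum.inl ⁻¹' s : Set α)) := by
      let _ : MeasurableSpace (α ⊕ Unit) := borel _
      have : BorelSpace (α ⊕ Unit) := ⟨rfl⟩
      exact (IsOpenEmbedding.inl (X := α) (Y := Unit)).measurableEmbedding.measurableSet_image'
        hs'.1
    have h2 : @MeasurableSet _ (borel (WithNaO α)) (Sum.inr '' (Sum.inr ⁻¹' s : Set Unit)) := by
      let _ : MeasurableSpace (α ⊕ Unit) := borel _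
      have : BorelSpace (α ⊕ Unit) := ⟨rfl⟩
      exact (IsOpenEmbedding.inr (X := α) (Y := Unit)).measurableEmbedding.measurableSet_image'
        hs'.2
    have h3 := @MeasurableSet.union _ (borel (WithNaO α)) _ _ h1 h2
    rwa [Set.image_preimage_inl_union_image_preimage_inr] at h3
  · refine MeasurableSpace.generateFrom_le fun s hs => ?_
    have hs : IsOpen s := hs
    exact measurableSet_sum_iff.2
      ⟨(hs.preimage continuous_inl).measurableSet, (hs.preimage continuous_inr).measurableSet⟩

instance instSecondCountableWithNaO {α : Type*} [TopologicalSpace α]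
    [SecondCountableTopology α] : SecondCountableTopology (WithNaO α) :=
  inferInstanceAs (SecondCountableTopology (α ⊕ Unit))

instance instSecondCountableEitherWithNaO {α β : Type*} [TopologicalSpace α]
    [SecondCountableTopology α] [TopologicalSpace β] :
    SecondCountableTopologyEither (WithNaO α) β := ⟨Or.inl inferInstance⟩

/-! ### The space `C²(ℝᵖ)` -/

/-- Twice continuously differentiable functions `ℝᵖ → ℝ`. -/
structure C2 (p : ℕ) where
  /-- the underlying function -/
  toFun : Euc p → ℝ
  contDiff_toFun : ContDiff ℝ 2 toFun

namespace C2

variable {p : ℕ}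

instance instCoeFun : CoeFun (C2 p) (fun _ => Euc p → ℝ) := ⟨C2.toFun⟩

/-- The gradient `∇q(δ)`. -/
def grad (q : C2 p) (δ : Euc p) : Euc p := gradient q.toFun δ

/-- The Hessian matrix `∇²q(δ)` of second partial derivatives. -/
def hess (q : C2 p) (δ : Euc p) : Mat p :=
  Matrix.of fun i j => fderiv ℝ (fderiv ℝ q.toFun) δ
    (EuclideanSpace.single i 1) (EuclideanSpace.single j 1)

/-- Minus the Hessian, `-∇²q(δ)`. -/
def negHess (q : C2 p) (δ : Euc p) : Mat p := -q.hess δ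

theorem continuous_grad (q : C2 p) : Continuous q.grad := by
  have h : Continuous (fderiv ℝ q.toFun) := q.contDiff_toFun.continuous_fderiv (by norm_num)
  exact (InnerProductSpace.toDual ℝ (Euc p)).symm.continuous.comp h

theorem continuous_hess (q : C2 p) : Continuous q.hess := by
  have h1 : ContDiff ℝ 1 (fderiv ℝ q.toFun) :=
    q.contDiff_toFun.fderiv_right (by norm_num)
  have h : Continuous (fderiv ℝ (fderiv ℝ q.toFun)) := h1.continuous_fderiv (by norm_num)
  refine continuous_matrix fun i j => ?_
  exact (h.clm_apply continuous_const).clm_apply continuous_const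

/-- A function with its first and second derivatives, as continuous maps. -/
def jet (q : C2 p) : C(Euc p, ℝ) × C(Euc p, Euc p) × C(Euc p, Mat p) :=
  (⟨q.toFun, q.contDiff_toFun.continuous⟩, ⟨q.grad, q.continuous_grad⟩,
    ⟨q.hess, q.continuous_hess⟩)

/-- The topology of uniform convergence on compact sets of the functions and their first and
second partial derivatives. -/
instance instTopologicalSpace : TopologicalSpace (C2 p) :=
  TopologicalSpace.induced jet inferInstance

instance instMeasurableSpace : MeasurableSpace (C2 p) := borel _

instance instBorelSpace : BorelSpace (C2 p) := ⟨rfl⟩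

instance instSecondCountableTopology : SecondCountableTopology (C2 p) :=
  TopologicalSpace.secondCountableTopology_induced _ _ jet

end C2

/-! ### Newton's method -/

variable {p : ℕ}

open Classical in
/-- The one-step Newton map `G(q, δ) = δ + (-∇²q(δ))⁻¹ ∇q(δ)` when `-∇²q(δ)` is positive
definite, and NaO otherwise; NaO propagates. -/
def newtonMap (q : C2 p) : WithNaO (Euc p) → WithNaO (Euc p)
  | Sum.inl δ =>
      if (q.negHess δ).PosDef then Sum.inl (δ + app (q.negHess δ)⁻¹ (q.grad δ)) else NaO
  | Sum.inr _ => NaO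

/-- The Newton iterates started at `δ`. -/
def newtonIter (q : C2 p) (δ : WithNaO (Euc p)) (k : ℕ) : WithNaO (Euc p) :=
  (newtonMap q)^[k] δ

open Classical in
/-- The infinite-step Newton map `G^∞`: the limit of the Newton iterates if they converge, and NaO
otherwise. -/
def newtonLimit (q : C2 p) (δ : WithNaO (Euc p)) : WithNaO (Euc p) :=
  if h : ∃ a, Tendsto (newtonIter q δ) atTop (𝓝 a) then h.choose else NaO

/-- `-∇²q` at a possibly non-existing point; NaO propagates. -/
def negHessN (q : C2 p) : WithNaO (Euc p) → WithNaO (Mat p)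
  | Sum.inl δ => Sum.inl (q.negHess δ)
  | Sum.inr _ => NaO

open Classical in
/-- The symmetric square root of a positive definite matrix, NaO for all other arguments. -/
def sqrtN : WithNaO (Mat p) → WithNaO (Mat p)
  | Sum.inl A => if A.PosDef then Sum.inl (CFC.sqrt A) else NaO
  | Sum.inr _ => NaO

/-- Matrix times vector; NaO propagates. -/
def appN : WithNaO (Mat p) → WithNaO (Euc p) → WithNaO (Euc p)
  | Sum.inl A, Sum.inl v => Sum.inl (app A v)
  | _, _ => NaO

/-! ### Statistical models and log likelihoods -/

/-- A parametric family of probability distributions on the sample space `𝓧`, with parameter space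
`ℝᵖ` and almost surely positive densities with respect to a measure. -/
structure StatModel (p : ℕ) (𝓧 : Type*) [MeasurableSpace 𝓧] where
  /-- the dominating measure -/
  base : Measure 𝓧
  /-- the densities -/
  density : Euc p → 𝓧 → ℝ
  measurable_density : ∀ θ, Measurable (density θ)
  density_pos : ∀ θ, ∀ᵐ x ∂base, 0 < density θ x
  lintegral_density : ∀ θ, ∫⁻ x, ENNReal.ofReal (density θ x) ∂base = 1

namespace StatModel

variable {𝓧 : Type*} [MeasurableSpace 𝓧]

/-- The distribution of the data for the parameter value `θ`. -/
def dist (M : StatModel p 𝓧) (θ : Euc p) : Measure 𝓧 :=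
  M.base.withDensity fun x => ENNReal.ofReal (M.density θ x)

/-- The function `l` of the data with values in `C²(ℝᵖ)` is a log likelihood of the model:
`l(θ) = u(X) + log f_θ(X)` with `u` not depending on the parameter. -/
def IsLogLikelihood (M : StatModel p 𝓧) (l : 𝓧 → C2 p) : Prop :=
  ∃ u : 𝓧 → ℝ, ∀ θ, ∀ᵐ x ∂M.base, l x θ = u x + Real.log (M.density θ x)

/-- `q(δ) = δ'Z - ½ δ'Kδ` is the log likelihood of an LAMN (locally asymptotically mixed normal)
model: `K` is almost surely (symmetric) positive definite and its distribution does not depend on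
the parameter. -/
structure IsLAMN (M : StatModel p 𝓧) (q : 𝓧 → C2 p) (Z : 𝓧 → Euc p) (K : 𝓧 → Mat p) :
    Prop where
  isLogLikelihood : M.IsLogLikelihood q
  measurable_Z : Measurable Z
  measurable_K : Measurable K
  quadratic : ∀ᵐ x ∂M.base, ∀ δ : Euc p,
    q x δ = inner ℝ δ (Z x) - (1 / 2) * inner ℝ δ (app (K x) δ)
  posDef : ∀ᵐ x ∂M.base, (K x).PosDef
  invariant : ∀ θ, (M.dist θ).map K = (M.dist 0).map K

end StatModel

end NewtonMLE

end

open NewtonMLE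

/-! Every statistic in the theorem is one fixed function `newtonStats` of the pair (log likelihood,
starting point). By the mapping theorem it suffices that this function is Borel measurable and is
continuous at almost every point for the limit law, that is, at `(q, δ₀)` with `q` a strictly
concave quadratic. The separate limits are then projections of the joint one.

Continuity is deterministic (`exists_tendsto_newton`, `eventually_newtonLimit`). Take a ball around
the maximum `a = K⁻¹Z` that contains `δ₀`. A function close to `q` in `C²` has minus Hessian
uniformly close to `K` on this ball and a small gradient at `a`. Newton's map then sends the ball to
itself, its steps shrink by the factor 1/2, and the iterates converge to a point near `a`. The
square root and the product are continuous there because the limit Hessian is positive definite.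

Normality of `K^{-1/2}Z` comes from the LAMN structure alone. The likelihood ratio of `δ` to `0` is
`exp(δ'Z - ½δ'Kδ)`, and the law of `K` is the same under both, so the ratio integrates over `{K ∈
B}` to `P(K ∈ B)`. Hence, given `K`, the Laplace transform of `Z` is `exp(½δ'Kδ)`, that of `N(0,
K)`. This is carried out without conditional laws, by restricting to events `{K ∈ B}` with `B`
bounded (`restrict_map_eq_of_bounded`) and exhausting (`map_sqrt_inv_app_eq_stdGaussian`). -/

namespace NewtonMLE

/-- **Continuous mapping theorem** for a map that is continuous almost everywhere with respect to
the limit law. -/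
theorem tendstoInDistribution_comp_of_ae_continuousAt {ι E F Ω' : Type*} {Ω : ι → Type*}
    [∀ i, MeasurableSpace (Ω i)] [MeasurableSpace Ω']
    {μ : ∀ i, Measure (Ω i)} [∀ i, IsProbabilityMeasure (μ i)]
    {μ' : Measure Ω'} [IsProbabilityMeasure μ']
    [TopologicalSpace E] [MeasurableSpace E] [OpensMeasurableSpace E] [HasOuterApproxClosed E]
    [TopologicalSpace F] [MeasurableSpace F] [OpensMeasurableSpace F]
    {X : ∀ i, Ω i → E} {Z : Ω' → E} {l : Filter ι} [l.IsCountablyGenerated] {g : E → F}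
    (hg : Measurable g) (h : TendstoInDistribution X l Z μ μ')
    (hc : ∀ᵐ ω ∂μ', ContinuousAt g (Z ω)) :
    TendstoInDistribution (fun i ω => g (X i ω)) l (fun ω => g (Z ω)) μ μ' where
  forall_aemeasurable i := hg.comp_aemeasurable (h.forall_aemeasurable i)
  aemeasurable_limit := hg.comp_aemeasurable h.aemeasurable_limit
  tendsto := by
    refine tendsto_of_forall_isOpen_le_liminf' fun G hG => ?_
    have hI : IsOpen (interior (g ⁻¹' G)) := isOpen_interior
    have key := ProbabilityMeasure.le_liminf_measure_open_of_tendsto h.tendsto hI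
    simp only [ProbabilityMeasure.coe_mk] at key
    change μ'.map (fun ω => g (Z ω)) G ≤ liminf (fun i => (μ i).map (fun ω => g (X i ω)) G) l
    have hgX i : AEMeasurable (fun ω => g (X i ω)) (μ i) :=
      hg.comp_aemeasurable (h.forall_aemeasurable i)
    have hgZ : AEMeasurable (fun ω => g (Z ω)) μ' := hg.comp_aemeasurable h.aemeasurable_limit
    rw [Measure.map_apply_of_aemeasurable h.aemeasurable_limit hI.measurableSet] at key
    rw [Measure.map_apply_of_aemeasurable hgZ hG.measurableSet]
    -- The preimage of an open set is a neighbourhood of each of its continuity points, so passing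
    -- to the interior loses only a null set in the limit.
    have h1 : μ' ((fun ω => g (Z ω)) ⁻¹' G) ≤ μ' (Z ⁻¹' interior (g ⁻¹' G)) := by
      refine measure_mono_ae ?_
      filter_upwards [hc] with ω hω hωG
      exact mem_interior_iff_mem_nhds.2 (hω.preimage_mem_nhds (hG.mem_nhds hωG))
    refine h1.trans (key.trans (liminf_le_liminf (Eventually.of_forall fun i => ?_)))
    rw [Measure.map_apply_of_aemeasurable (h.forall_aemeasurable i) hI.measurableSet,
      Measure.map_apply_of_aemeasurable (hgX i) hG.measurableSet]
    exact measure_mono (Set.preimage_mono interior_subset)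

/-! ### Continuity and measurability of the operations in Newton's method -/

variable {p : ℕ}

/-- Provides the outer approximation of closed sets that the mapping theorem asks of its source
space. -/
instance : TopologicalSpace.PseudoMetrizableSpace (C2 p) :=
  IsInducing.pseudoMetrizableSpace (f := C2.jet) ⟨rfl⟩

namespace C2

theorem continuous_grad_apply : Continuous fun x : C2 p × Euc p => x.1.grad x.2 := by
  have h : Continuous (C2.jet (p := p)) := continuous_induced_dom
  exact continuous_eval.comp
    ((continuous_fst.comp (continuous_snd.comp (h.comp continuous_fst))).prodMk continuous_snd)

theorem continuous_negHess_apply : Continuous fun x : C2 p × Euc p => x.1.negHess x.2 := by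
  have h : Continuous (C2.jet (p := p)) := continuous_induced_dom
  exact (continuous_eval.comp
    ((continuous_snd.comp (continuous_snd.comp (h.comp continuous_fst))).prodMk
      continuous_snd)).neg

end C2

theorem continuous_app : Continuous fun x : Mat p × Euc p => app x.1 x.2 := by
  have : (fun x : Mat p × Euc p => app x.1 x.2) =
      fun x => WithLp.toLp 2 (x.1.mulVec (WithLp.ofLp x.2)) := by
    ext x i
    simp [app]
  rw [this]
  fun_prop

theorem measurable_app {α : Type*} [MeasurableSpace α] {f : α → Mat p} {g : α → Euc p}
    (hf : Measurable f) (hg : Measurable g) : Measurable fun x => app (f x) (g x) := by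
  have h : Measurable fun x : Mat p × Euc p => app x.1 x.2 := continuous_app.measurable
  have h' := h.comp (hf.prodMk hg)
  exact h'

theorem measurable_matrix_inv : Measurable fun A : Mat p => A⁻¹ := by
  have : (fun A : Mat p => A⁻¹) = fun A => (A.det)⁻¹ • A.adjugate := by
    ext1 A
    rw [Matrix.inv_def, Ring.inverse_eq_inv']
  rw [this]
  have h1 : Measurable fun A : Mat p => A.det := (Continuous.matrix_det continuous_id).measurable
  have h2 : Measurable fun A : Mat p => A.adjugate :=
    (Continuous.matrix_adjugate continuous_id).measurable
  exact h1.inv.smul h2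

theorem isClosed_setOf_posSemidef : IsClosed {A : Mat p | A.PosSemidef} := by
  have : {A : Mat p | A.PosSemidef} = {A | A.conjTranspose = A} ∩
      ⋂ v : Fin p → ℝ, {A : Mat p | 0 ≤ star v ⬝ᵥ A.mulVec v} := by
    ext A
    simp only [Set.mem_ofPred_eq, Set.mem_inter_iff, Set.mem_iInter]
    exact Matrix.posSemidef_iff_dotProduct_mulVec
  rw [this]
  refine (isClosed_eq (Continuous.matrix_conjTranspose continuous_id) continuous_id).inter
    (isClosed_iInter fun v => isClosed_le continuous_const ?_)
  fun_prop

/-- Positive definiteness is open only among symmetric matrices, so the set is written as a closed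
set minus the zeros of the determinant. -/
theorem measurableSet_setOf_posDef : MeasurableSet {A : Mat p | A.PosDef} := by
  have : {A : Mat p | A.PosDef} = {A | A.PosSemidef} ∩ {A | A.det ≠ 0} := by
    ext A
    constructor
    · intro h
      exact ⟨h.posSemidef, h.det_pos.ne'⟩
    · rintro ⟨h1, h2⟩
      exact h1.posDef_iff_isUnit.2 ((Matrix.isUnit_iff_isUnit_det A).2 (isUnit_iff_ne_zero.2 h2))
  rw [this]
  exact isClosed_setOf_posSemidef.measurableSet.inter
    ((Continuous.matrix_det continuous_id).measurable (measurableSet_singleton 0).compl)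

open scoped Matrix.Norms.L2Operator in
theorem continuousOn_matrix_sqrt :
    ContinuousOn (fun A : Mat p => CFC.sqrt A) {A | A.PosSemidef} := by
  exact ContinuousOn.cfcₙ_nnreal_of_mem_nhdsSet (s := Set.univ) (A := Mat p) NNReal.sqrt
    univ_mem continuousOn_id (fun A hA => Matrix.nonneg_iff_posSemidef.2 hA)

theorem measurable_matrix_sqrt : Measurable fun A : Mat p => CFC.sqrt A := by
  classical
  have h := (continuousOn_matrix_sqrt (p := p)).measurable_piecewise
    (continuousOn_const (c := (0 : Mat p))) isClosed_setOf_posSemidef.measurableSet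
  convert! h using 2 with A
  by_cases hA : A.PosSemidef
  · simp [hA]
  · simp only [Set.piecewise, Set.mem_ofPred_eq, hA, if_false]
    -- Off the positive semidefinite matrices the functional calculus takes the default value 0.
    exact cfcₙ_apply_of_not_predicate A fun h => hA (Matrix.nonneg_iff_posSemidef.1 h)

theorem measurable_withNaO_prod {α β γ : Type*} [MeasurableSpace α] [MeasurableSpace β]
    [MeasurableSpace γ] {f : α × WithNaO β → γ}
    (h : Measurable fun x : α × β => f (x.1, Sum.inl x.2))
    (h' : Measurable fun x : α => f (x, NaO)) : Measurable f := by
  rw [← (MeasurableEquiv.prodSumDistrib α β Unit).symm.measurable_comp_iff]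
  exact measurable_fun_sum h (h'.comp measurable_fst)

open Classical in
theorem measurable_newtonMap :
    Measurable fun x : C2 p × WithNaO (Euc p) => newtonMap x.1 x.2 := by
  have hH : Measurable fun x : C2 p × Euc p => x.1.negHess x.2 :=
    C2.continuous_negHess_apply.measurable
  have hg : Measurable fun x : C2 p × Euc p => x.1.grad x.2 := C2.continuous_grad_apply.measurable
  have hinv : Measurable fun x : C2 p × Euc p => (x.1.negHess x.2)⁻¹ :=
    measurable_matrix_inv.comp hH
  have happ : Measurable fun x : C2 p × Euc p => app (x.1.negHess x.2)⁻¹ (x.1.grad x.2) :=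
    measurable_app hinv hg
  have hstep : Measurable fun x : C2 p × Euc p =>
      (Sum.inl (x.2 + app (x.1.negHess x.2)⁻¹ (x.1.grad x.2)) : WithNaO (Euc p)) :=
    measurable_inl.comp (measurable_snd.add happ)
  have hS : MeasurableSet {x : C2 p × Euc p | (x.1.negHess x.2).PosDef} :=
    hH measurableSet_setOf_posDef
  have hite : Measurable fun x : C2 p × Euc p =>
      if (x.1.negHess x.2).PosDef
        then (Sum.inl (x.2 + app (x.1.negHess x.2)⁻¹ (x.1.grad x.2)) : WithNaO (Euc p))
        else NaO :=
    Measurable.ite hS hstep measurable_const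
  exact measurable_withNaO_prod hite measurable_const

theorem measurable_newtonIter (k : ℕ) :
    Measurable fun x : C2 p × WithNaO (Euc p) => newtonIter x.1 x.2 k := by
  induction k with
  | zero => exact measurable_snd
  | succ k ih =>
    simp only [newtonIter, Function.iterate_succ_apply'] at ih ⊢
    exact measurable_newtonMap.comp (measurable_fst.prodMk ih)

theorem newtonLimit_eq {q : C2 p} {δ a : WithNaO (Euc p)}
    (h : Tendsto (newtonIter q δ) atTop (𝓝 a)) : newtonLimit q δ = a := by
  have h' : ∃ a, Tendsto (newtonIter q δ) atTop (𝓝 a) := ⟨a, h⟩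
  rw [newtonLimit, dif_pos h']
  exact tendsto_nhds_unique h'.choose_spec h

theorem measurable_newtonLimit :
    Measurable fun x : C2 p × WithNaO (Euc p) => newtonLimit x.1 x.2 := by
  classical
  have hS : MeasurableSet {x : C2 p × WithNaO (Euc p) |
      ∃ a, Tendsto (newtonIter x.1 x.2) atTop (𝓝 a)} :=
    measurableSet_exists_tendsto (fun k => measurable_newtonIter k)
  -- Replacing the iterates by NaO off the measurable convergence set makes them converge
  -- everywhere, to `newtonLimit`.
  have hlim : Tendsto (fun k (x : C2 p × WithNaO (Euc p)) =>
      if ∃ a, Tendsto (newtonIter x.1 x.2) atTop (𝓝 a) then newtonIter x.1 x.2 k else NaO)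
      atTop (𝓝 fun x => newtonLimit x.1 x.2) := by
    rw [tendsto_pi_nhds]
    intro x
    by_cases h : ∃ a, Tendsto (newtonIter x.1 x.2) atTop (𝓝 a)
    · obtain ⟨a, ha⟩ := h
      rw [newtonLimit_eq ha]
      simpa only [if_pos (⟨a, ha⟩ : ∃ a, Tendsto (newtonIter x.1 x.2) atTop (𝓝 a))] using ha
    · simp only [if_neg h, newtonLimit, dif_neg h]
      exact tendsto_const_nhds
  exact measurable_of_tendsto_metrizable
    (fun k => Measurable.ite hS (measurable_newtonIter k) measurable_const) hlim

theorem measurable_negHessN :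
    Measurable fun x : C2 p × WithNaO (Euc p) => negHessN x.1 x.2 :=
  measurable_withNaO_prod (measurable_inl.comp C2.continuous_negHess_apply.measurable)
    measurable_const

open Classical in
theorem measurable_sqrtN : Measurable (sqrtN (p := p)) := by
  refine measurable_fun_sum ?_ measurable_const
  have h : Measurable fun A : Mat p =>
      if A.PosDef then (Sum.inl (CFC.sqrt A) : WithNaO (Mat p)) else NaO :=
    Measurable.ite measurableSet_setOf_posDef (measurable_inl.comp measurable_matrix_sqrt)
      measurable_const
  exact h

theorem measurable_appN :
    Measurable fun x : WithNaO (Mat p) × WithNaO (Euc p) => appN x.1 x.2 := by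
  refine measurable_withNaO_prod ?_ ?_
  · have h1 : Measurable fun x : Euc p × Mat p => (Sum.inl (app x.2 x.1) : WithNaO (Euc p)) :=
      measurable_inl.comp (measurable_app measurable_snd measurable_fst)
    have h2 : Measurable fun x : Euc p × WithNaO (Mat p) => appN x.2 (Sum.inl x.1) :=
      measurable_withNaO_prod h1 measurable_const
    exact h2.comp measurable_swap
  · exact measurable_fun_sum measurable_const measurable_const

/-! ### Newton's method with a nearly constant derivative -/

section Abstract

variable {E : Type*} [NormedAddCommGroup E] [NormedSpace ℝ E] [CompleteSpace E]

/-- Convergence of Newton's method for the equation `g = 0` on a ball on which the derivative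
`-H` of `g` is nearly constant. -/
theorem exists_tendsto_newton {g N : E → E} {H : E → E →L[ℝ] E} {A : E →L[ℝ] E} {a : E}
    {R m ε : ℝ} (hm : 0 < m) (hε : 2 * ε ≤ R)
    (hg : ∀ x ∈ Metric.closedBall a R, HasFDerivAt g (-(H x)) x)
    (hH : ∀ x ∈ Metric.closedBall a R, ‖H x - A‖ ≤ m / 4)
    (hcoer : ∀ x ∈ Metric.closedBall a R, ∀ v, m * ‖v‖ ≤ ‖H x v‖)
    (hN : ∀ x ∈ Metric.closedBall a R, H x (N x - x) = g x)
    (ha : ‖g a‖ ≤ m * ε) {x₀ : E} (hx₀ : x₀ ∈ Metric.closedBall a R) :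
    (∀ k, N^[k] x₀ ∈ Metric.closedBall a R) ∧
      ∃ y, Tendsto (fun k => N^[k] x₀) atTop (𝓝 y) ∧ ‖y - a‖ ≤ 2 * ε := by
  have hR : 0 ≤ R := dist_nonneg.trans hx₀
  have haB : a ∈ Metric.closedBall a R := Metric.mem_closedBall_self hR
  -- Mean value inequality for `g + A`, whose derivative `A - H` has norm at most `m / 4`.
  have hmv : ∀ x ∈ Metric.closedBall a R, ∀ y ∈ Metric.closedBall a R,
      ‖g y - g x + A (y - x)‖ ≤ m / 4 * ‖y - x‖ := by
    intro x hx y hy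
    have := (convex_closedBall a R).norm_image_sub_le_of_norm_hasFDerivWithin_le'
      (φ := -A) (C := m / 4) (fun z hz => (hg z hz).hasFDerivWithinAt)
      (fun z hz => by simpa [← norm_neg (H z - A), neg_add_eq_sub] using hH z hz) hx hy
    rwa [neg_apply, sub_neg_eq_add] at this
  have hHA : ∀ x ∈ Metric.closedBall a R, ∀ v, ‖H x v - A v‖ ≤ m / 4 * ‖v‖ := fun x hx v =>
    ((H x - A).le_opNorm v).trans (mul_le_mul_of_nonneg_right (hH x hx) (norm_nonneg v))
  -- `H x (N x - a)` splits into two errors of size `m / 4 * ‖x - a‖` and the term `g a` of size `m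
  -- * ε`; coercivity divides by `m`.
  have hstep : ∀ x ∈ Metric.closedBall a R, ‖N x - a‖ ≤ 1 / 2 * ‖x - a‖ + ε := by
    intro x hx
    have h1 : H x (N x - a) = (g x - g a + A (x - a)) + (H x (x - a) - A (x - a)) + g a := by
      have : N x - a = (N x - x) + (x - a) := by abel
      rw [this, map_add, hN x hx]; abel
    have h2 := hcoer x hx (N x - a)
    have h3 := norm_add₃_le (a := g x - g a + A (x - a)) (b := H x (x - a) - A (x - a))
      (c := g a)
    rw [← h1] at h3
    have h4 := hmv a haB x hx
    have h5 := hHA x hx (x - a)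
    refine le_of_mul_le_mul_left ?_ hm
    linarith
  have hball : ∀ x ∈ Metric.closedBall a R, N x ∈ Metric.closedBall a R := by
    intro x hx
    have := hstep x hx
    rw [mem_closedBall_iff_norm] at hx ⊢
    linarith
  -- The Newton equation at `x` cancels `g x`, so only the two `m / 4` errors remain and the steps
  -- contract.
  have hcontr : ∀ x ∈ Metric.closedBall a R, ‖N (N x) - N x‖ ≤ 1 / 2 * ‖N x - x‖ := by
    intro x hx
    have hNx := hball x hx
    have h1 : H (N x) (N (N x) - N x)
        = (g (N x) - g x + A (N x - x)) + (H x (N x - x) - A (N x - x)) := by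
      rw [hN _ hNx, hN x hx]; abel
    have h2 := hcoer _ hNx (N (N x) - N x)
    rw [h1] at h2
    have h3 := h2.trans (norm_add_le _ _)
    have h4 := hmv x hx _ hNx
    have h5 := hHA x hx (N x - x)
    refine le_of_mul_le_mul_left ?_ hm
    linarith
  have hmem : ∀ k, N^[k] x₀ ∈ Metric.closedBall a R := by
    intro k
    induction k with
    | zero => exact hx₀
    | succ k ih => rw [Function.iterate_succ_apply']; exact hball _ ih
  refine ⟨hmem, ?_⟩
  have hgeom : ∀ k, dist (N^[k] x₀) (N^[k + 1] x₀) ≤ ‖N x₀ - x₀‖ * (1 / 2) ^ k := by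
    intro k
    rw [dist_comm, dist_eq_norm]
    induction k with
    | zero => simp
    | succ k ih =>
      have := hcontr _ (hmem k)
      rw [Function.iterate_succ_apply' N (k + 1), Function.iterate_succ_apply' N k] at *
      calc _ ≤ _ := this
        _ ≤ 1 / 2 * (‖N x₀ - x₀‖ * (1 / 2) ^ k) := by gcongr
        _ = _ := by ring
  obtain ⟨y, hy⟩ := cauchySeq_tendsto_of_complete
    (cauchySeq_of_le_geometric (1 / 2) _ (by norm_num) hgeom)
  refine ⟨y, hy, ?_⟩
  -- `2 * ε` is the fixed point of the recursion `t ↦ t / 2 + ε` from `hstep`.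
  have hbd : ∀ k, ‖N^[k] x₀ - a‖ ≤ (1 / 2) ^ k * ‖x₀ - a‖ + 2 * ε := by
    have hε0 : 0 ≤ ε := nonneg_of_mul_nonneg_right ((norm_nonneg _).trans ha) hm
    intro k
    induction k with
    | zero => simp; linarith
    | succ k ih =>
      have := hstep _ (hmem k)
      rw [Function.iterate_succ_apply', pow_succ]
      linarith
  have hlim : Tendsto (fun k : ℕ => (1 / 2 : ℝ) ^ k * ‖x₀ - a‖ + 2 * ε) atTop (𝓝 (2 * ε)) := by
    simpa using ((tendsto_pow_atTop_nhds_zero_of_lt_one (r := (1 / 2 : ℝ)) (by norm_num)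
      (by norm_num)).mul_const ‖x₀ - a‖).add_const (2 * ε)
  exact le_of_tendsto_of_tendsto' (hy.sub_const a).norm hlim hbd

end Abstract

/-! ### Quadratic forms, Hessians and coercivity -/

theorem inner_app_eq_dotProduct (A : Mat p) (v w : Euc p) :
    inner ℝ v (app A w) = WithLp.ofLp v ⬝ᵥ A.mulVec (WithLp.ofLp w) := by
  rw [EuclideanSpace.inner_eq_star_dotProduct]
  simp [app, dotProduct_comm]

theorem inner_app_comm {K : Mat p} (hK : K.IsHermitian) (v w : Euc p) :
    inner ℝ v (app K w) = inner ℝ w (app K v) := by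
  have hKT : K.transpose = K := by simpa [Matrix.IsHermitian] using hK
  rw [inner_app_eq_dotProduct, inner_app_eq_dotProduct, Matrix.dotProduct_mulVec, dotProduct_comm,
    ← Matrix.mulVec_transpose, hKT]

theorem app_mul (A B : Mat p) (v : Euc p) : app (A * B) v = app A (app B v) := by
  rw [app, map_mul, mul_apply_eq_comp]

theorem continuous_toEuclideanCLM :
    Continuous fun A : Mat p => Matrix.toEuclideanCLM (𝕜 := ℝ) A :=
  LinearMap.continuous_of_finiteDimensional
    (Matrix.toEuclideanCLM (𝕜 := ℝ) (n := Fin p)).toAlgEquiv.toLinearMap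

/-- A continuous positive function on the compact unit sphere is bounded below by a positive
constant; homogeneity does the rest. -/
theorem exists_coercive_of_posDef {K : Mat p} (hK : K.PosDef) :
    ∃ m : ℝ, 0 < m ∧ ∀ v : Euc p, m * ‖v‖ ^ 2 ≤ inner ℝ v (app K v) := by
  have hpos : ∀ v : Euc p, v ≠ 0 → 0 < inner ℝ v (app K v) := by
    intro v hv
    rw [inner_app_eq_dotProduct]
    have := hK.dotProduct_mulVec_pos (x := WithLp.ofLp v) (by simpa using hv)
    simpa using this
  have hcont : ContinuousOn (fun v : Euc p => (inner ℝ v (app K v) : ℝ)) (Metric.sphere 0 1) := by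
    fun_prop
  obtain ⟨m, hm, hle⟩ := (isCompact_sphere (0 : Euc p) 1).exists_forall_le' hcont (a := 0)
    (fun v hv => hpos v (by rintro rfl; simp at hv))
  refine ⟨m, hm, fun v => ?_⟩
  rcases eq_or_ne v 0 with rfl | hv
  · simp
  have hn : 0 < ‖v‖ := norm_pos_iff.2 hv
  have := hle (‖v‖⁻¹ • v) (by simp [norm_smul, hn.ne'])
  simp only [map_smul, inner_smul_left, inner_smul_right, app] at this
  simp at this
  rw [← mul_assoc, ← mul_inv, ← div_eq_inv_mul, le_div_iff₀ (by positivity)] at this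
  rw [pow_two]; exact this

namespace C2

theorem hasFDerivAt_grad (q : C2 p) (x : Euc p) :
    HasFDerivAt q.grad (-(Matrix.toEuclideanCLM (𝕜 := ℝ) (q.negHess x))) x := by
  have hD : HasFDerivAt (fderiv ℝ q.toFun) (fderiv ℝ (fderiv ℝ q.toFun) x) x :=
    ((q.contDiff_toFun.fderiv_right (m := 1) (by norm_num)).differentiable
      (by norm_num) x).hasFDerivAt
  have hsymm := (q.contDiff_toFun.contDiffAt (x := x)).isSymmSndFDerivAt (by simp)
  rw [← hasFDerivWithinAt_univ, hasFDerivWithinAt_euclidean]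
  intro i
  rw [hasFDerivWithinAt_univ]
  have hgi : (fun y => q.grad y i) =
      fun y => fderiv ℝ q.toFun y (EuclideanSpace.single i 1) := by
    ext y
    rw [← InnerProductSpace.toDual_symm_apply (𝕜 := ℝ) (y := fderiv ℝ q.toFun y),
      EuclideanSpace.inner_single_right]
    simp [grad, gradient]
  rw [hgi]
  refine (hD.clm_apply (hasFDerivAt_const (EuclideanSpace.single i (1 : ℝ)) x)).congr_fderiv ?_
  ext v
  have hv : v = ∑ j, v j • EuclideanSpace.single j (1 : ℝ) := by
    ext k; simp [Finset.sum_apply, Pi.single_apply]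
  have h1 : fderiv ℝ (fderiv ℝ q.toFun) x v (EuclideanSpace.single i 1)
      = ∑ j, q.hess x i j * v j := by
    -- Differentiating component `i` of the gradient puts `v` in the first slot, whereas `hess` has
    -- `i` there; symmetry exchanges them.
    rw [hsymm.eq]
    conv_lhs => rw [hv]
    simp [hess, mul_comm]
  simp [h1, negHess, Matrix.mulVec, dotProduct]

theorem isHermitian_negHess (q : C2 p) (x : Euc p) : (q.negHess x).IsHermitian := by
  have h := (q.contDiff_toFun.contDiffAt (x := x)).isSymmSndFDerivAt (by simp)
  ext i j
  simp [negHess, hess, h _ _]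

theorem grad_of_quadratic {q : C2 p} {Z : Euc p} {K : Mat p} (hK : K.IsHermitian)
    (hq : ∀ δ : Euc p, q δ = inner ℝ δ Z - (1 / 2) * inner ℝ δ (app K δ)) (δ : Euc p) :
    q.grad δ = Z - app K δ := by
  have hfun : q.toFun = fun δ => inner ℝ δ Z - (1 / 2) * inner ℝ δ (app K δ) := funext hq
  have hid : HasFDerivAt (fun δ : Euc p => δ) (ContinuousLinearMap.id ℝ (Euc p)) δ :=
    hasFDerivAt_id δ
  have hKd : HasFDerivAt (fun δ : Euc p => app K δ) (Matrix.toEuclideanCLM (𝕜 := ℝ) K) δ :=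
    (Matrix.toEuclideanCLM (𝕜 := ℝ) K).hasFDerivAt
  have h := (hid.inner ℝ (hasFDerivAt_const Z δ)).sub ((hid.inner ℝ hKd).const_mul (1 / 2))
  have hg : HasGradientAt q.toFun (Z - app K δ) δ := by
    rw [hasGradientAt_iff_hasFDerivAt, hfun]
    refine h.congr_fderiv ?_
    ext v
    have h1 := inner_app_comm hK δ v
    simp only [app] at h1
    simp [h1, real_inner_comm v Z,
      real_inner_comm v ((Matrix.toEuclideanCLM (𝕜 := ℝ) K) δ)]
    ring
  exact hg.gradient

/-- The gradient is affine, so uniqueness of its derivative identifies the Hessian without computing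
second partials. -/
theorem negHess_of_quadratic {q : C2 p} {Z : Euc p} {K : Mat p} (hK : K.IsHermitian)
    (hq : ∀ δ : Euc p, q δ = inner ℝ δ Z - (1 / 2) * inner ℝ δ (app K δ)) (δ : Euc p) :
    q.negHess δ = K := by
  have h1 := q.hasFDerivAt_grad δ
  have h2 : HasFDerivAt q.grad (-(Matrix.toEuclideanCLM (𝕜 := ℝ) K)) δ := by
    rw [funext (grad_of_quadratic hK hq)]
    exact (Matrix.toEuclideanCLM (𝕜 := ℝ) K).hasFDerivAt.const_sub Z
  exact (Matrix.toEuclideanCLM (𝕜 := ℝ) (n := Fin p)).injective (neg_injective (h1.unique h2))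

end C2

theorem app_inv_app {A : Mat p} (hA : IsUnit A.det) (v : Euc p) : app A (app A⁻¹ v) = v := by
  rw [← app_mul, Matrix.mul_nonsing_inv A hA, app, map_one]
  rfl

theorem inv_app_app {A : Mat p} (hA : IsUnit A.det) (v : Euc p) : app A⁻¹ (app A v) = v := by
  rw [← app_mul, Matrix.nonsing_inv_mul A hA, app, map_one]
  rfl

/-- Cauchy–Schwarz: a perturbation of norm at most `m` costs at most half of the constant `2 * m`.
-/
theorem coercive_of_norm_sub_le {A K : Mat p} {m : ℝ}
    (hm : ∀ v : Euc p, 2 * m * ‖v‖ ^ 2 ≤ inner ℝ v (app K v))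
    (hA : ‖Matrix.toEuclideanCLM (𝕜 := ℝ) A - Matrix.toEuclideanCLM (𝕜 := ℝ) K‖ ≤ m)
    (v : Euc p) : m * ‖v‖ ^ 2 ≤ inner ℝ v (app A v) := by
  have h1 : |inner ℝ v (app A v - app K v)| ≤ ‖v‖ * (m * ‖v‖) := by
    refine (abs_real_inner_le_norm _ _).trans (mul_le_mul_of_nonneg_left ?_ (norm_nonneg v))
    exact ((Matrix.toEuclideanCLM (𝕜 := ℝ) A - Matrix.toEuclideanCLM (𝕜 := ℝ) K).le_opNorm v).trans
      (mul_le_mul_of_nonneg_right hA (norm_nonneg v))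
  have h2 := hm v
  have h3 := neg_le_of_abs_le h1
  rw [inner_sub_right] at h3
  nlinarith

theorem posDef_of_coercive {A : Mat p} (hA : A.IsHermitian) {m : ℝ} (hm : 0 < m)
    (h : ∀ v : Euc p, m * ‖v‖ ^ 2 ≤ inner ℝ v (app A v)) : A.PosDef := by
  refine Matrix.PosDef.of_dotProduct_mulVec_pos hA fun x hx => ?_
  have h1 := h (WithLp.toLp 2 x)
  rw [inner_app_eq_dotProduct] at h1
  have h2 : 0 < ‖WithLp.toLp 2 x‖ := norm_pos_iff.2 (by simpa using hx)
  have h3 : 0 < m * ‖WithLp.toLp 2 x‖ ^ 2 := by positivity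
  simpa using h3.trans_le h1

theorem norm_app_ge_of_coercive {A : Mat p} {m : ℝ}
    (h : ∀ v : Euc p, m * ‖v‖ ^ 2 ≤ inner ℝ v (app A v)) (v : Euc p) :
    m * ‖v‖ ≤ ‖app A v‖ := by
  rcases eq_or_ne v 0 with rfl | hv
  · simp
  refine le_of_mul_le_mul_left ?_ (norm_pos_iff.2 hv)
  have := (h v).trans (real_inner_le_norm v (app A v))
  linarith

theorem eventually_posDef {α : Type*} {l : Filter α} {H : α → Mat p} {K : Mat p}
    (hK : K.PosDef) (hH : Tendsto H l (𝓝 K)) (hherm : ∀ x, (H x).IsHermitian) :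
    ∀ᶠ x in l, (H x).PosDef := by
  obtain ⟨m, hm, hcoer⟩ := exists_coercive_of_posDef hK
  have h : Tendsto (fun x => ‖Matrix.toEuclideanCLM (𝕜 := ℝ) (H x)
      - Matrix.toEuclideanCLM (𝕜 := ℝ) K‖) l (𝓝 0) := by
    simpa using (((continuous_toEuclideanCLM.tendsto K).comp hH).sub_const
      (Matrix.toEuclideanCLM (𝕜 := ℝ) K)).norm
  filter_upwards [h.eventually_le_const (half_pos hm)] with x hx
  exact posDef_of_coercive (hherm x) (half_pos hm) (coercive_of_norm_sub_le
    (fun v => by rw [mul_div_cancel₀ _ two_ne_zero]; exact hcoer v) hx)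

theorem isUnit_det_sqrt {K : Mat p} (hK : K.PosDef) : IsUnit (CFC.sqrt K).det :=
  (Matrix.isUnit_iff_isUnit_det _).1
    ((CFC.isUnit_sqrt_iff K (Matrix.nonneg_iff_posSemidef.2 hK.posSemidef)).2 hK.isUnit)

theorem norm_app_sqrt_sq {K : Mat p} (hK : K.PosSemidef) (v : Euc p) :
    ‖app (CFC.sqrt K) v‖ ^ 2 = inner ℝ v (app K v) := by
  have hS : (CFC.sqrt K).IsHermitian :=
    (Matrix.nonneg_iff_posSemidef.1 (CFC.sqrt_nonneg K)).isHermitian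
  rw [← real_inner_self_eq_norm_sq, inner_app_comm hS, ← app_mul,
    CFC.sqrt_mul_sqrt_self K (Matrix.nonneg_iff_posSemidef.2 hK)]

theorem app_sqrt_app_inv {K : Mat p} (hK : K.PosDef) (v : Euc p) :
    app (CFC.sqrt K) (app K⁻¹ v) = app (CFC.sqrt K)⁻¹ v := by
  have hS := isUnit_det_sqrt hK
  have hKK := CFC.sqrt_mul_sqrt_self K (Matrix.nonneg_iff_posSemidef.2 hK.posSemidef)
  have h : K⁻¹ = (CFC.sqrt K)⁻¹ * (CFC.sqrt K)⁻¹ := by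
    conv_lhs => rw [← hKK]
    rw [Matrix.mul_inv_rev]
  rw [h, app_mul, app_inv_app hS]

/-! ### Continuity of the infinite-step Newton map at a quadratic -/

/-- Near a strictly concave quadratic, Newton's method converges to a point near its maximum. -/
theorem eventually_newtonLimit {q : C2 p} {K : Mat p} {a : Euc p} (hK : K.PosDef)
    (hgrad : q.grad a = 0) (hhess : ∀ δ, q.negHess δ = K) (δ₀ : Euc p) {ε : ℝ} (hε : 0 < ε) :
    ∀ᶠ x : C2 p × Euc p in 𝓝 (q, δ₀),
      ∃ y : Euc p, newtonLimit x.1 (Sum.inl x.2) = Sum.inl y ∧ dist y a < ε := by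
  obtain ⟨m', hm', hcoer'⟩ := exists_coercive_of_posDef hK
  set m := m' / 2 with hmdef
  have hm : 0 < m := by positivity
  have hcoer : ∀ v : Euc p, 2 * m * ‖v‖ ^ 2 ≤ inner ℝ v (app K v) := by
    intro v; rw [hmdef, mul_div_cancel₀ _ two_ne_zero]; exact hcoer' v
  -- The extra 1 puts `δ₀` in the interior, so nearby starting points also lie in the ball.
  set R := ‖δ₀ - a‖ + 1 with hR
  obtain ⟨ε', hε', hε1, hε2⟩ : ∃ ε' : ℝ, 0 < ε' ∧ 2 * ε' < ε ∧ 2 * ε' ≤ R := by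
    have hn := norm_nonneg (δ₀ - a)
    refine ⟨min (ε / 4) (1 / 2), by positivity, ?_, ?_⟩
    · linarith [min_le_left (ε / 4) (1 / 2)]
    · linarith [min_le_right (ε / 4) (1 / 2)]
  have hcontH : Continuous fun x : C2 p × Euc p =>
      ‖Matrix.toEuclideanCLM (𝕜 := ℝ) (x.1.negHess x.2) - Matrix.toEuclideanCLM (𝕜 := ℝ) K‖ := by
    exact ((continuous_toEuclideanCLM.comp C2.continuous_negHess_apply).sub continuous_const).norm
  -- Compactness of the ball turns joint continuity of the Hessian at each point into a bound
  -- uniform in `y`.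
  have hH : ∀ᶠ r : C2 p in 𝓝 q, ∀ y ∈ Metric.closedBall a R,
      ‖Matrix.toEuclideanCLM (𝕜 := ℝ) (r.negHess y) - Matrix.toEuclideanCLM (𝕜 := ℝ) K‖
        < m / 4 := by
    refine (isCompact_closedBall a R).eventually_forall_of_forall_eventually fun y _ => ?_
    refine hcontH.continuousAt.eventually_lt_const ?_
    simp only [hhess, sub_self, norm_zero]
    positivity
  have hg : ∀ᶠ r : C2 p in 𝓝 q, ‖r.grad a‖ < m * ε' := by
    have : Continuous fun r : C2 p => ‖r.grad a‖ :=
      (C2.continuous_grad_apply.comp (continuous_id.prodMk continuous_const)).norm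
    refine this.continuousAt.eventually_lt_const ?_
    simp only [hgrad, norm_zero]
    positivity
  have hδ : ∀ᶠ δ : Euc p in 𝓝 δ₀, δ ∈ Metric.closedBall a R := by
    refine Metric.closedBall_mem_nhds_of_mem ?_
    rw [mem_ball_iff_norm, hR]; linarith
  filter_upwards [(hH.and hg).prod_nhds hδ] with ⟨r, δ⟩ ⟨⟨hH, hg⟩, hδ⟩
  dsimp only at hH hg hδ ⊢
  have hco : ∀ x ∈ Metric.closedBall a R, ∀ v : Euc p,
      m * ‖v‖ ^ 2 ≤ inner ℝ v (app (r.negHess x) v) := fun x hx =>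
    coercive_of_norm_sub_le hcoer ((hH x hx).le.trans (by linarith))
  have hpd : ∀ x ∈ Metric.closedBall a R, (r.negHess x).PosDef := fun x hx =>
    posDef_of_coercive (r.isHermitian_negHess x) hm (hco x hx)
  obtain ⟨hmem, y, hy, hya⟩ := exists_tendsto_newton
    (g := r.grad) (N := fun x => x + app (r.negHess x)⁻¹ (r.grad x))
    (H := fun x => Matrix.toEuclideanCLM (𝕜 := ℝ) (r.negHess x))
    (A := Matrix.toEuclideanCLM (𝕜 := ℝ) K) (a := a) hm hε2
    (fun x _ => r.hasFDerivAt_grad x) (fun x hx => (hH x hx).le)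
    (fun x hx => norm_app_ge_of_coercive (hco x hx))
    (fun x hx => by
      rw [add_sub_cancel_left]
      exact app_inv_app (hpd x hx).det_pos.ne'.isUnit _) hg.le hδ
  refine ⟨y, newtonLimit_eq ?_, by rw [dist_eq_norm]; linarith⟩
  -- The iterates stay in the ball, where the Hessian condition holds, so NaO never occurs.
  have hiter : ∀ k, newtonIter r (Sum.inl δ) k =
      Sum.inl ((fun x => x + app (r.negHess x)⁻¹ (r.grad x))^[k] δ) := by
    intro k
    induction k with
    | zero => rfl
    | succ k ih =>
      rw [newtonIter, Function.iterate_succ_apply'] at *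
      rw [ih, newtonMap, if_pos (hpd _ (hmem k)), Function.iterate_succ_apply']
  rw [funext hiter]
  exact (continuous_inl.tendsto y).comp hy

/-- The preceding neighbourhood statement holds at `(q, δ₀)` itself for every `ε`, which forces the
limit to be `a`. -/
theorem newtonLimit_of_quadratic {q : C2 p} {K : Mat p} {a : Euc p} (hK : K.PosDef)
    (hgrad : q.grad a = 0) (hhess : ∀ δ, q.negHess δ = K) (δ₀ : Euc p) :
    newtonLimit q (Sum.inl δ₀) = Sum.inl a := by
  have h : ∀ ε > 0, ∃ y : Euc p, newtonLimit q (Sum.inl δ₀) = Sum.inl y ∧ dist y a < ε :=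
    fun ε hε => (eventually_newtonLimit hK hgrad hhess δ₀ hε).self_of_nhds
  obtain ⟨y, hy, -⟩ := h 1 one_pos
  have : y = a := by
    refine eq_of_forall_dist_le fun ε hε => ?_
    obtain ⟨z, hz, hza⟩ := h ε hε
    rw [hy] at hz
    exact (Sum.inl.inj hz) ▸ hza.le
  rw [hy, this]

theorem continuousAt_newtonLimit {q : C2 p} {K : Mat p} {a : Euc p} (hK : K.PosDef)
    (hgrad : q.grad a = 0) (hhess : ∀ δ, q.negHess δ = K) (δ₀ : Euc p) :
    ContinuousAt (fun x : C2 p × Euc p => newtonLimit x.1 (Sum.inl x.2)) (q, δ₀) := by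
  rw [ContinuousAt, newtonLimit_of_quadratic hK hgrad hhess, nhds_inl]
  intro s hs
  obtain ⟨ε, hε, hball⟩ := Metric.mem_nhds_iff.1 (mem_map.1 hs)
  refine mem_map.2 ?_
  filter_upwards [eventually_newtonLimit hK hgrad hhess δ₀ hε] with x ⟨y, hy, hya⟩
  rw [Set.mem_preimage, hy]
  exact hball hya

/-! ### Laplace transforms and Gaussian measures -/

/-- Finite measures on the line with equal and everywhere finite two-sided Laplace transforms
are equal. -/
theorem map_eq_of_lintegral_exp {Ω₁ Ω₂ : Type*} [MeasurableSpace Ω₁] [MeasurableSpace Ω₂]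
    {μ : Measure Ω₁} {ν : Measure Ω₂} [IsFiniteMeasure μ] [IsFiniteMeasure ν]
    {X : Ω₁ → ℝ} {Y : Ω₂ → ℝ} (hX : AEMeasurable X μ) (hY : AEMeasurable Y ν)
    (h : ∀ s : ℝ, ∫⁻ x, ENNReal.ofReal (Real.exp (s * X x)) ∂μ
      = ∫⁻ y, ENNReal.ofReal (Real.exp (s * Y y)) ∂ν)
    (hfin : ∀ s : ℝ, ∫⁻ x, ENNReal.ofReal (Real.exp (s * X x)) ∂μ ≠ ⊤) :
    μ.map X = ν.map Y := by
  have hm : mgf X μ = mgf Y ν := by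
    ext s
    rw [mgf, mgf, integral_eq_lintegral_of_nonneg_ae (ae_of_all _ fun _ => (Real.exp_pos _).le)
      (by fun_prop), integral_eq_lintegral_of_nonneg_ae (ae_of_all _ fun _ => (Real.exp_pos _).le)
      (by fun_prop), h s]
  -- All exponential moments are finite, so equality of the real transforms extends to the whole
  -- complex plane.
  have hset : integrableExpSet X μ = Set.univ := by
    refine Set.eq_univ_of_forall fun s => ?_
    refine ⟨by fun_prop, ?_⟩
    rw [hasFiniteIntegral_iff_ofReal (ae_of_all _ fun _ => (Real.exp_pos _).le)]
    exact (hfin s).lt_top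
  have h0 : μ = 0 ↔ ν = 0 := by
    rw [← Measure.measure_univ_eq_zero, ← Measure.measure_univ_eq_zero]
    have := h 0
    simp only [zero_mul, Real.exp_zero, ENNReal.ofReal_one, lintegral_one] at this
    rw [this]
  refine Measure.ext_of_complexMGF_eq hX hY (funext fun z => ?_)
  exact eqOn_complexMGF_of_mgf' hm h0 (by simp [hset])

/-- The Cramér–Wold theorem for finite measures. -/
theorem measure_ext_of_map_inner {E : Type*} [NormedAddCommGroup E] [InnerProductSpace ℝ E]
    [CompleteSpace E] [SecondCountableTopology E] [MeasurableSpace E] [BorelSpace E]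
    {μ ν : Measure E} [IsFiniteMeasure μ] [IsFiniteMeasure ν]
    (h : ∀ t : E, μ.map (fun x => inner ℝ t x) = ν.map (fun x => inner ℝ t x)) : μ = ν := by
  refine Measure.ext_of_charFunDual (funext fun L => ?_)
  obtain ⟨t, rfl⟩ := (InnerProductSpace.toDual ℝ E).surjective L
  rw [charFunDual_eq_charFun_map_one, charFunDual_eq_charFun_map_one]
  have := h t
  have e : ⇑((InnerProductSpace.toDual ℝ E) t) = fun x => inner ℝ t x := by
    ext x; simp
  rw [e, this]

theorem lintegral_exp_inner_stdGaussian {E : Type*} [NormedAddCommGroup E]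
    [InnerProductSpace ℝ E] [FiniteDimensional ℝ E] [MeasurableSpace E] [BorelSpace E] (u : E) :
    ∫⁻ x, ENNReal.ofReal (Real.exp (inner ℝ u x)) ∂(stdGaussian E)
      = ENNReal.ofReal (Real.exp (‖u‖ ^ 2 / 2)) := by
  have hmap : (stdGaussian E).map (InnerProductSpace.toDual ℝ E u)
      = gaussianReal 0 (‖u‖ ^ 2).toNNReal := by
    rw [IsGaussian.map_eq_gaussianReal]
    rw [integral_strongDual_stdGaussian, variance_dual_stdGaussian, LinearIsometryEquiv.norm_map]
  have h1 : ∫⁻ x, ENNReal.ofReal (Real.exp (inner ℝ u x)) ∂(stdGaussian E)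
      = ∫⁻ y, ENNReal.ofReal (Real.exp (1 * y)) ∂(gaussianReal 0 (‖u‖ ^ 2).toNNReal) := by
    rw [← hmap, lintegral_map (by fun_prop) (by fun_prop)]
    simp
  have hint : Integrable (fun y : ℝ => Real.exp (1 * y)) (gaussianReal 0 (‖u‖ ^ 2).toNNReal) :=
    integrable_exp_mul_gaussianReal 1
  rw [h1, ← ofReal_integral_eq_lintegral_ofReal hint (ae_of_all _ fun _ => (Real.exp_pos _).le)]
  have h2 := mgf_gaussianReal (X := id) (p := gaussianReal 0 (‖u‖ ^ 2).toNNReal)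
    (Measure.map_id) 1
  simp only [mgf, id] at h2
  rw [h2]
  simp

/-! ### Likelihood ratios in an LAMN model -/

namespace StatModel

variable {𝓧 : Type*} [MeasurableSpace 𝓧]

theorem isProbabilityMeasure_dist (M : StatModel p 𝓧) (θ : Euc p) :
    IsProbabilityMeasure (M.dist θ) :=
  ⟨by rw [dist, withDensity_apply _ MeasurableSet.univ, Measure.restrict_univ,
    M.lintegral_density]⟩

theorem dist_absolutelyContinuous (M : StatModel p 𝓧) (θ : Euc p) : M.dist θ ≪ M.base :=
  withDensity_absolutelyContinuous _ _

namespace IsLAMN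

variable {M : StatModel p 𝓧} {q : 𝓧 → C2 p} {Z : 𝓧 → Euc p} {K : 𝓧 → Mat p}

/-- The quadratic vanishes at `δ = 0`, so subtracting the log likelihood there removes the arbitrary
term `u`. -/
theorem density_eq (h : M.IsLAMN q Z K) (δ : Euc p) :
    ∀ᵐ x ∂M.base, M.density δ x = M.density 0 x *
      Real.exp (inner ℝ δ (Z x) - (1 / 2) * inner ℝ δ (app (K x) δ)) := by
  obtain ⟨u, hu⟩ := h.isLogLikelihood
  filter_upwards [hu 0, hu δ, h.quadratic, M.density_pos 0, M.density_pos δ]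
    with x h0 hδ hq p0 pδ
  rw [hq] at h0 hδ
  simp only [inner_zero_left, mul_zero, sub_zero] at h0
  rw [hδ, show u x + Real.log (M.density δ x) = Real.log (M.density δ x) -
    Real.log (M.density 0 x) by linarith, Real.exp_sub, Real.exp_log pδ, Real.exp_log p0,
    mul_div_cancel₀ _ p0.ne']

/-- The integrand is the likelihood ratio of `δ` to `0`, so the integral is the probability of `K ∈
B` under `δ`, which is free of `δ`. -/
theorem setLIntegral_exp (h : M.IsLAMN q Z K) (δ : Euc p) {B : Set (Mat p)}
    (hB : MeasurableSet B) :
    ∫⁻ x in K ⁻¹' B, ENNReal.ofReal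
      (Real.exp (inner ℝ δ (Z x) - (1 / 2) * inner ℝ δ (app (K x) δ))) ∂(M.dist 0)
      = M.dist 0 (K ⁻¹' B) := by
  have hKB : MeasurableSet (K ⁻¹' B) := h.measurable_K hB
  have hZ := h.measurable_Z
  have happ : Measurable fun x => app (K x) δ := measurable_app h.measurable_K measurable_const
  have hf0 : Measurable fun x => ENNReal.ofReal (M.density 0 x) :=
    (M.measurable_density 0).ennreal_ofReal
  have hinv : M.dist δ (K ⁻¹' B) = M.dist 0 (K ⁻¹' B) := by
    rw [← Measure.map_apply h.measurable_K hB, h.invariant,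
      Measure.map_apply h.measurable_K hB]
  rw [← hinv, dist, dist, restrict_withDensity hKB,
    lintegral_withDensity_eq_lintegral_mul _ hf0 (by fun_prop), withDensity_apply _ hKB]
  refine lintegral_congr_ae (ae_restrict_of_ae ?_)
  filter_upwards [h.density_eq δ, M.density_pos 0] with x hx p0
  rw [Pi.mul_apply, ← ENNReal.ofReal_mul p0.le, hx]

end IsLAMN

end StatModel

/-! ### Mixed normality of `Z` given `K` -/

section Mixed

variable {Ω : Type*} [MeasurableSpace Ω] {μ : Measure Ω}
  {Z : Ω → Euc p} {K : Ω → Mat p}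

/-- An integrated form of `E[exp(δ'Z) | K] = exp(½δ'Kδ)`: weighting by the likelihood ratio
preserves the law of `K`, so a function of `K` can be moved across it. -/
theorem setLIntegral_exp_inner (hZ : Measurable Z) (hK : Measurable K)
    (h : ∀ (δ : Euc p) (B : Set (Mat p)), MeasurableSet B →
      ∫⁻ x in K ⁻¹' B, ENNReal.ofReal
        (Real.exp (inner ℝ δ (Z x) - (1 / 2) * inner ℝ δ (app (K x) δ))) ∂μ = μ (K ⁻¹' B))
    (δ : Euc p) {B : Set (Mat p)} (hB : MeasurableSet B) :
    ∫⁻ x in K ⁻¹' B, ENNReal.ofReal (Real.exp (inner ℝ δ (Z x))) ∂μ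
      = ∫⁻ x in K ⁻¹' B, ENNReal.ofReal (Real.exp ((1 / 2) * inner ℝ δ (app (K x) δ))) ∂μ := by
  have happ : Measurable fun x => app (K x) δ := measurable_app hK measurable_const
  have happ' : Measurable fun A : Mat p => app A δ := measurable_app measurable_id measurable_const
  set w : Ω → ENNReal := fun x => ENNReal.ofReal
    (Real.exp (inner ℝ δ (Z x) - (1 / 2) * inner ℝ δ (app (K x) δ))) with hw
  have hwm : Measurable w := by fun_prop
  have hmap : (μ.withDensity w).map K = μ.map K := by
    ext B hB
    rw [Measure.map_apply hK hB, Measure.map_apply hK hB, withDensity_apply _ (hK hB), h δ B hB]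
  set g : Mat p → ENNReal := fun A => ENNReal.ofReal (Real.exp ((1 / 2) * inner ℝ δ (app A δ)))
    with hg
  have hgm : Measurable g := by fun_prop
  have h1 : ∫⁻ A in B, g A ∂((μ.withDensity w).map K) = ∫⁻ A in B, g A ∂(μ.map K) := by
    rw [hmap]
  rw [setLIntegral_map hB hgm hK, setLIntegral_map hB hgm hK, restrict_withDensity (hK hB),
    lintegral_withDensity_eq_lintegral_mul (g := fun x => g (K x)) _ hwm (hgm.comp hK)] at h1
  rw [← h1]
  refine lintegral_congr fun x => ?_
  rw [Pi.mul_apply, hw, hg]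
  dsimp only
  rw [← ENNReal.ofReal_mul (Real.exp_pos _).le, ← Real.exp_add, sub_add_cancel]

variable [IsProbabilityMeasure μ]

/-- With a standard normal `ξ` independent of `K`, `K^{1/2}ξ` has the same Laplace transform as `Z`
in every direction. Boundedness of `B` keeps the transforms finite, as their uniqueness theorem
requires. -/
theorem restrict_map_eq_of_bounded (hZ : Measurable Z) (hK : Measurable K)
    (hpd : ∀ᵐ x ∂μ, (K x).PosDef)
    (h : ∀ (δ : Euc p) (B : Set (Mat p)), MeasurableSet B →
      ∫⁻ x in K ⁻¹' B, ENNReal.ofReal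
        (Real.exp (inner ℝ δ (Z x) - (1 / 2) * inner ℝ δ (app (K x) δ))) ∂μ = μ (K ⁻¹' B))
    {B : Set (Mat p)} (hB : MeasurableSet B) {N : ℝ}
    (hN : ∀ A ∈ B, ‖Matrix.toEuclideanCLM (𝕜 := ℝ) A‖ ≤ N) :
    (μ.restrict (K ⁻¹' B)).map Z = ((μ.restrict (K ⁻¹' B)).prod (stdGaussian (Euc p))).map
      (fun y => app (CFC.sqrt (K y.1)) y.2) := by
  have hW : Measurable fun y : Ω × Euc p => app (CFC.sqrt (K y.1)) y.2 :=
    measurable_app ((measurable_matrix_sqrt.comp hK).comp measurable_fst) measurable_snd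
  have hleft : ∀ (s : ℝ) (t : Euc p),
      ∫⁻ x in K ⁻¹' B, ENNReal.ofReal (Real.exp (s * inner ℝ t (Z x))) ∂μ
      = ∫⁻ x in K ⁻¹' B, ENNReal.ofReal
          (Real.exp ((1 / 2) * inner ℝ (s • t) (app (K x) (s • t)))) ∂μ := by
    intro s t
    rw [← setLIntegral_exp_inner hZ hK h (s • t) hB]
    simp only [real_inner_smul_left]
  refine measure_ext_of_map_inner fun t => ?_
  rw [Measure.map_map (by fun_prop) hZ, Measure.map_map (by fun_prop) hW]
  have hWt : Measurable fun y : Ω × Euc p => inner ℝ t (app (CFC.sqrt (K y.1)) y.2) := by fun_prop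
  refine map_eq_of_lintegral_exp (by fun_prop) hWt.aemeasurable (fun s => ?_) (fun s => ?_)
  · simp only [Function.comp_apply]
    have hexp : Measurable fun y : Ω × Euc p =>
        ENNReal.ofReal (Real.exp (s * inner ℝ t (app (CFC.sqrt (K y.1)) y.2))) :=
      (hWt.const_mul s).exp.ennreal_ofReal
    have hprod := lintegral_prod (μ := μ.restrict (K ⁻¹' B)) (ν := stdGaussian (Euc p)) _
      hexp.aemeasurable
    rw [hleft, hprod]
    refine lintegral_congr_ae (ae_restrict_of_ae ?_)
    filter_upwards [hpd] with x hx
    have hS : (CFC.sqrt (K x)).IsHermitian :=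
      (Matrix.nonneg_iff_posSemidef.1 (CFC.sqrt_nonneg (K x))).isHermitian
    have e : ∀ ξ : Euc p, s * inner ℝ t (app (CFC.sqrt (K x)) ξ)
        = inner ℝ (app (CFC.sqrt (K x)) (s • t)) ξ := by
      intro ξ
      rw [inner_app_comm hS, app, app, map_smul, real_inner_smul_left, real_inner_comm]
    simp only [e]
    rw [lintegral_exp_inner_stdGaussian, norm_app_sqrt_sq hx.posSemidef]
    congr 2
    ring
  · simp only [Function.comp_apply]
    rw [hleft]
    have hle : ∫⁻ x in K ⁻¹' B, ENNReal.ofReal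
          (Real.exp ((1 / 2) * inner ℝ (s • t) (app (K x) (s • t)))) ∂μ
        ≤ ∫⁻ _ in K ⁻¹' B, ENNReal.ofReal
          (Real.exp ((1 / 2) * (‖s • t‖ * (N * ‖s • t‖)))) ∂μ := by
      refine setLIntegral_mono' (hK hB) fun x hx => ENNReal.ofReal_le_ofReal ?_
      gcongr
      refine (real_inner_le_norm _ _).trans ?_
      gcongr
      exact ((Matrix.toEuclideanCLM (𝕜 := ℝ) (K x)).le_opNorm _).trans
        (mul_le_mul_of_nonneg_right (hN _ hx) (norm_nonneg _))
    refine ne_top_of_le_ne_top ?_ hle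
    rw [setLIntegral_const]
    exact ENNReal.mul_ne_top ENNReal.ofReal_ne_top (measure_ne_top _ _)

/-- On a rectangle `C ×ˢ D`, the event `K ∈ D` is absorbed by replacing `B` with `D ∩ B`. -/
theorem restrict_map_prodMk_eq_of_bounded (hZ : Measurable Z) (hK : Measurable K)
    (hpd : ∀ᵐ x ∂μ, (K x).PosDef)
    (h : ∀ (δ : Euc p) (B : Set (Mat p)), MeasurableSet B →
      ∫⁻ x in K ⁻¹' B, ENNReal.ofReal
        (Real.exp (inner ℝ δ (Z x) - (1 / 2) * inner ℝ δ (app (K x) δ))) ∂μ = μ (K ⁻¹' B))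
    {B : Set (Mat p)} (hB : MeasurableSet B) {N : ℝ}
    (hN : ∀ A ∈ B, ‖Matrix.toEuclideanCLM (𝕜 := ℝ) A‖ ≤ N) :
    (μ.restrict (K ⁻¹' B)).map (fun x => (Z x, K x)) =
      ((μ.restrict (K ⁻¹' B)).prod (stdGaussian (Euc p))).map
        (fun y => (app (CFC.sqrt (K y.1)) y.2, K y.1)) := by
  have hW : Measurable fun y : Ω × Euc p => app (CFC.sqrt (K y.1)) y.2 :=
    measurable_app ((measurable_matrix_sqrt.comp hK).comp measurable_fst) measurable_snd
  have hWK : Measurable fun y : Ω × Euc p => (app (CFC.sqrt (K y.1)) y.2, K y.1) :=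
    hW.prodMk (hK.comp measurable_fst)
  refine Measure.ext_prod fun {C D} hC hD => ?_
  have hKD : MeasurableSet (K ⁻¹' D) := hK hD
  have key := congrArg (fun ρ : Measure (Euc p) => ρ C)
    (restrict_map_eq_of_bounded hZ hK hpd h (hD.inter hB) (fun A hA => hN A hA.2))
  rw [Set.preimage_inter, ← Measure.restrict_restrict hKD, Measure.map_apply hZ hC,
    Measure.map_apply hW hC, Measure.restrict_apply (hZ hC)] at key
  rw [Measure.map_apply (hZ.prodMk hK) (hC.prod hD),
    Measure.map_apply hWK (hC.prod hD), Set.mk_preimage_prod, key,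
    ← Measure.restrict_univ (μ := stdGaussian (Euc p)), Measure.prod_restrict,
    Measure.restrict_univ, Measure.restrict_apply (hW hC), Set.mk_preimage_prod, Set.prod_univ]
  rfl

/-- A mixed normal vector `Z` with mixing covariance `K`, standardized by `K^{-1/2}`, is standard
normal. -/
theorem map_sqrt_inv_app_eq_stdGaussian (hZ : Measurable Z) (hK : Measurable K)
    (hpd : ∀ᵐ x ∂μ, (K x).PosDef)
    (h : ∀ (δ : Euc p) (B : Set (Mat p)), MeasurableSet B →
      ∫⁻ x in K ⁻¹' B, ENNReal.ofReal
        (Real.exp (inner ℝ δ (Z x) - (1 / 2) * inner ℝ δ (app (K x) δ))) ∂μ = μ (K ⁻¹' B)) :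
    μ.map (fun x => app (CFC.sqrt (K x))⁻¹ (Z x)) = stdGaussian (Euc p) := by
  have hF : Measurable fun z : Euc p × Mat p => app (CFC.sqrt z.2)⁻¹ z.1 :=
    measurable_app ((measurable_matrix_inv.comp measurable_matrix_sqrt).comp measurable_snd)
      measurable_fst
  have hFZ : Measurable fun x => app (CFC.sqrt (K x))⁻¹ (Z x) := by
    have := hF.comp (hZ.prodMk hK)
    exact this
  have hW : Measurable fun y : Ω × Euc p => (app (CFC.sqrt (K y.1)) y.2, K y.1) :=
    (measurable_app ((measurable_matrix_sqrt.comp hK).comp measurable_fst) measurable_snd).prodMk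
      (hK.comp measurable_fst)
  set B : ℕ → Set (Mat p) := fun N => {A | ‖Matrix.toEuclideanCLM (𝕜 := ℝ) A‖ ≤ N} with hBdef
  have hB : ∀ N, MeasurableSet (B N) := fun N =>
    (isClosed_le continuous_toEuclideanCLM.norm continuous_const).measurableSet
  have hN : ∀ N, (μ.restrict (K ⁻¹' B N)).map (fun x => app (CFC.sqrt (K x))⁻¹ (Z x))
      = μ (K ⁻¹' B N) • stdGaussian (Euc p) := by
    intro N
    have h1 := restrict_map_prodMk_eq_of_bounded hZ hK hpd h (hB N) (N := N) (fun A hA => hA)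
    have h2 := congrArg (Measure.map fun z : Euc p × Mat p => app (CFC.sqrt z.2)⁻¹ z.1) h1
    rw [Measure.map_map hF (hZ.prodMk hK), Measure.map_map hF hW] at h2
    refine h2.trans ?_
    -- Almost surely the inverse root cancels the root, leaving the Gaussian coordinate.
    have hae : ∀ᵐ y ∂((μ.restrict (K ⁻¹' B N)).prod (stdGaussian (Euc p))), (K y.1).PosDef :=
      Measure.quasiMeasurePreserving_fst.ae (ae_restrict_of_ae hpd)
    rw [Measure.map_congr (g := Prod.snd), Measure.map_snd_prod, Measure.restrict_apply_univ]
    filter_upwards [hae] with y hy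
    exact inv_app_app (isUnit_det_sqrt hy) y.2
  have hmono : Monotone fun N => K ⁻¹' B N := fun a b hab x (hx : _ ≤ _) =>
    (hx.trans (Nat.cast_le.2 hab) : _ ≤ (b : ℝ))
  have hunion : ⋃ N, K ⁻¹' B N = Set.univ := by
    refine Set.eq_univ_of_forall fun x => Set.mem_iUnion.2 ?_
    exact exists_nat_ge ‖Matrix.toEuclideanCLM (𝕜 := ℝ) (K x)‖
  ext S hS
  have hS' := hFZ hS
  have hl : ∀ N, μ ((fun x => app (CFC.sqrt (K x))⁻¹ (Z x)) ⁻¹' S ∩ K ⁻¹' B N)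
      = μ (K ⁻¹' B N) * stdGaussian (Euc p) S := by
    intro N
    rw [← Measure.restrict_apply hS', ← Measure.map_apply hFZ hS, hN N]
    rfl
  -- The bounded sets exhaust all matrices, so both sides of `hl` pass to the limit.
  have t1 := tendsto_measure_iUnion_atTop (μ := μ) hmono
  rw [hunion, measure_univ] at t1
  have t2 := tendsto_measure_iUnion_atTop (μ := μ)
    (s := fun N => (fun x => app (CFC.sqrt (K x))⁻¹ (Z x)) ⁻¹' S ∩ K ⁻¹' B N)
    (fun a b hab => Set.inter_subset_inter_right _ (hmono hab))
  rw [← Set.inter_iUnion, hunion, Set.inter_univ] at t2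
  have t3 : Tendsto (fun N => μ (K ⁻¹' B N) * stdGaussian (Euc p) S) atTop
      (𝓝 (1 * stdGaussian (Euc p) S)) :=
    ENNReal.Tendsto.mul_const t1 (Or.inl one_ne_zero)
  rw [Measure.map_apply hFZ hS, ← one_mul (stdGaussian (Euc p) S)]
  exact tendsto_nhds_unique (t2.congr hl) t3

end Mixed

/-! ### The joint statistic and its continuity at quadratics -/

theorem measurable_newtonLimit_inl :
    Measurable fun x : C2 p × Euc p => newtonLimit x.1 (Sum.inl x.2) := by
  have h := measurable_newtonLimit.comp
    (measurable_fst.prodMk (measurable_inl.comp measurable_snd) :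
      Measurable fun x : C2 p × Euc p => (x.1, (Sum.inl x.2 : WithNaO (Euc p))))
  exact h

/-- The statistics of interest as a function of the log likelihood and the starting
point. -/
noncomputable def newtonStats (x : C2 p × Euc p) :
    C2 p × Euc p × Mat p × WithNaO (Mat p) × WithNaO (Euc p) × WithNaO (Euc p) :=
  (x.1, x.2, x.1.negHess x.2, negHessN x.1 (newtonLimit x.1 (Sum.inl x.2)),
    newtonLimit x.1 (Sum.inl x.2),
    appN (sqrtN (negHessN x.1 (newtonLimit x.1 (Sum.inl x.2)))) (newtonLimit x.1 (Sum.inl x.2)))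

theorem measurable_newtonStats : Measurable (newtonStats (p := p)) := by
  have h1 := measurable_newtonLimit_inl (p := p)
  have h2 : Measurable fun x : C2 p × Euc p => negHessN x.1 (newtonLimit x.1 (Sum.inl x.2)) :=
    measurable_negHessN.comp (measurable_fst.prodMk h1)
  have h3 : Measurable fun x : C2 p × Euc p =>
      appN (sqrtN (negHessN x.1 (newtonLimit x.1 (Sum.inl x.2))))
        (newtonLimit x.1 (Sum.inl x.2)) :=
    measurable_appN.comp ((measurable_sqrtN.comp h2).prodMk h1)
  have h4 : Measurable fun x : C2 p × Euc p => x.1.negHess x.2 :=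
    C2.continuous_negHess_apply.measurable
  exact measurable_fst.prodMk (measurable_snd.prodMk (h4.prodMk (h2.prodMk (h1.prodMk h3))))

theorem newtonStats_of_quadratic {q : C2 p} {Z : Euc p} {K : Mat p} (hK : K.PosDef)
    (hq : ∀ δ : Euc p, q δ = inner ℝ δ Z - (1 / 2) * inner ℝ δ (app K δ)) (δ₀ : Euc p) :
    newtonStats (q, δ₀) = (q, δ₀, K, Sum.inl K, Sum.inl (app K⁻¹ Z),
      Sum.inl (app (CFC.sqrt K)⁻¹ Z)) := by
  have hhess := C2.negHess_of_quadratic hK.isHermitian hq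
  have hgrad : q.grad (app K⁻¹ Z) = 0 := by
    rw [C2.grad_of_quadratic hK.isHermitian hq, app_inv_app hK.det_pos.ne'.isUnit, sub_self]
  simp only [newtonStats, newtonLimit_of_quadratic hK hgrad hhess, hhess, negHessN, sqrtN,
    if_pos hK, appN, app_sqrt_app_inv hK]

theorem continuousAt_newtonStats {q : C2 p} {Z : Euc p} {K : Mat p} (hK : K.PosDef)
    (hq : ∀ δ : Euc p, q δ = inner ℝ δ Z - (1 / 2) * inner ℝ δ (app K δ)) (δ₀ : Euc p) :
    ContinuousAt newtonStats (q, δ₀) := by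
  have hhess := C2.negHess_of_quadratic hK.isHermitian hq
  have hgrad : q.grad (app K⁻¹ Z) = 0 := by
    rw [C2.grad_of_quadratic hK.isHermitian hq, app_inv_app hK.det_pos.ne'.isUnit, sub_self]
  have hval := newtonStats_of_quadratic hK hq δ₀
  have hG := continuousAt_newtonLimit hK hgrad hhess δ₀
  rw [ContinuousAt, newtonLimit_of_quadratic hK hgrad hhess] at hG
  -- The value 0 at NaO is arbitrary: genuine values form an open set, so near `(q, δ₀)` the Newton
  -- limit is genuine.
  set y : C2 p × Euc p → Euc p := fun x =>
    Sum.elim id (fun _ => 0) (newtonLimit x.1 (Sum.inl x.2)) with hy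
  have hycont : Tendsto y (𝓝 (q, δ₀)) (𝓝 (app K⁻¹ Z)) :=
    ((continuous_id.sumElim continuous_const).tendsto (Sum.inl (app K⁻¹ Z))).comp hG
  have hGy : ∀ᶠ x in 𝓝 (q, δ₀), newtonLimit x.1 (Sum.inl x.2) = Sum.inl (y x) := by
    filter_upwards [hG.eventually (isOpen_range_inl.mem_nhds ⟨_, rfl⟩)] with x ⟨z, hz⟩
    simp only [hy, ← hz, Sum.elim_inl, id]
  have hH : Tendsto (fun x : C2 p × Euc p => x.1.negHess (y x)) (𝓝 (q, δ₀)) (𝓝 K) := by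
    have h := (C2.continuous_negHess_apply.tendsto (q, app K⁻¹ Z)).comp
      ((continuous_fst.tendsto (q, δ₀)).prodMk_nhds hycont)
    simp only [hhess] at h
    exact h
  have hpd := eventually_posDef hK hH (fun x => x.1.isHermitian_negHess _)
  have hS : Tendsto (fun x : C2 p × Euc p => CFC.sqrt (x.1.negHess (y x))) (𝓝 (q, δ₀))
      (𝓝 (CFC.sqrt K)) :=
    (continuousOn_matrix_sqrt K hK.posSemidef).tendsto.comp
      (tendsto_nhdsWithin_iff.2 ⟨hH, hpd.mono fun x hx => hx.posSemidef⟩)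
  have hSy : Tendsto (fun x : C2 p × Euc p => app (CFC.sqrt (x.1.negHess (y x))) (y x))
      (𝓝 (q, δ₀)) (𝓝 (app (CFC.sqrt K)⁻¹ Z)) := by
    have h := (continuous_app.tendsto (CFC.sqrt K, app K⁻¹ Z)).comp (hS.prodMk_nhds hycont)
    rw [app_sqrt_app_inv hK] at h
    exact h
  have h3 : Tendsto (fun x : C2 p × Euc p => x.1.negHess x.2) (𝓝 (q, δ₀)) (𝓝 K) := by
    have h := C2.continuous_negHess_apply.tendsto (q, δ₀)
    rwa [hhess] at h
  rw [ContinuousAt, hval]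
  have hmain : Tendsto (fun x : C2 p × Euc p => (x.1, x.2, x.1.negHess x.2,
      (Sum.inl (x.1.negHess (y x)) : WithNaO (Mat p)), (Sum.inl (y x) : WithNaO (Euc p)),
      (Sum.inl (app (CFC.sqrt (x.1.negHess (y x))) (y x)) : WithNaO (Euc p)))) (𝓝 (q, δ₀))
      (𝓝 (q, δ₀, K, Sum.inl K, Sum.inl (app K⁻¹ Z), Sum.inl (app (CFC.sqrt K)⁻¹ Z))) :=
    (continuous_fst.tendsto (q, δ₀)).prodMk_nhds <| (continuous_snd.tendsto (q, δ₀)).prodMk_nhds <|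
      h3.prodMk_nhds <| ((continuous_inl.tendsto _).comp hH).prodMk_nhds <|
      ((continuous_inl.tendsto _).comp hycont).prodMk_nhds ((continuous_inl.tendsto _).comp hSy)
  refine hmain.congr' ?_
  filter_upwards [hGy, hpd] with x hx hxpd
  simp only [newtonStats, hx, negHessN, sqrtN, if_pos hxpd, appN]

end NewtonMLE

/-! ### The limit theorem -/

open NewtonMLE
theorem theorem3 (p : ℕ)
    -- the models in the sequence, their log likelihoods, and their sample spaces
    {𝓧 : ℕ → Type*} [∀ n, MeasurableSpace (𝓧 n)]
    (M : ∀ n, StatModel p (𝓧 n)) (q : ∀ n, 𝓧 n → C2 p)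
    (hq : ∀ n, (M n).IsLogLikelihood (q n))
    -- the data `X n`, with true parameter value zero, and the starting points
    {Ω : ℕ → Type*} [∀ n, MeasurableSpace (Ω n)]
    (P : ∀ n, Measure (Ω n)) [∀ n, IsProbabilityMeasure (P n)]
    (X : ∀ n, Ω n → 𝓧 n) (hX : ∀ n, HasLaw (X n) ((M n).dist 0) (P n))
    (δt : ∀ n, Ω n → Euc p)
    -- the LAMN limit model
    {𝓧' : Type*} [MeasurableSpace 𝓧']
    (M' : StatModel p 𝓧') (q' : 𝓧' → C2 p) (Z : 𝓧' → Euc p) (K : 𝓧' → Mat p)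
    (hLAMN : M'.IsLAMN q' Z K)
    {Ω' : Type*} [MeasurableSpace Ω'] (P' : Measure Ω') [IsProbabilityMeasure P']
    (X' : Ω' → 𝓧') (hX' : HasLaw X' (M'.dist 0) P') (δt' : Ω' → Euc p)
    -- convergence in law in `C²(ℝᵖ) × ℝᵖ`
    (hconv : TendstoInDistribution (fun n ω => (q n (X n ω), δt n ω)) atTop
      (fun ω => (q' (X' ω), δt' ω)) P P')
    -- Newton's method iterated to convergence
    (δh : ∀ n, Ω n → WithNaO (Euc p))
    (hδh : ∀ n ω, δh n ω = newtonLimit (q n (X n ω)) (Sum.inl (δt n ω))) :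
    TendstoInDistribution (fun n ω => (q n (X n ω)).negHess (δt n ω)) atTop
      (fun ω => K (X' ω)) P P' ∧
    TendstoInDistribution (fun n ω => negHessN (q n (X n ω)) (δh n ω)) atTop
      (fun ω => (Sum.inl (K (X' ω)) : WithNaO (Mat p))) P P' ∧
    TendstoInDistribution δh atTop
      (fun ω => (Sum.inl (app (K (X' ω))⁻¹ (Z (X' ω))) : WithNaO (Euc p))) P P' ∧
    TendstoInDistribution
      (fun n ω => appN (sqrtN (negHessN (q n (X n ω)) (δh n ω))) (δh n ω)) atTop
      (Sum.inl : Euc p → WithNaO (Euc p)) P (multivariateGaussian 0 (1 : Mat p)) ∧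
    -- the joint convergence, in which the last limit is the standard normal vector `K^{-1/2} Z`
    HasLaw (fun ω => app (CFC.sqrt (K (X' ω)))⁻¹ (Z (X' ω)))
      (multivariateGaussian 0 (1 : Mat p)) P' ∧
    TendstoInDistribution
      (fun n ω => (q n (X n ω), δt n ω, (q n (X n ω)).negHess (δt n ω),
        negHessN (q n (X n ω)) (δh n ω), δh n ω,
        appN (sqrtN (negHessN (q n (X n ω)) (δh n ω))) (δh n ω))) atTop
      (fun ω => (q' (X' ω), δt' ω, K (X' ω), (Sum.inl (K (X' ω)) : WithNaO (Mat p)),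
        (Sum.inl (app (K (X' ω))⁻¹ (Z (X' ω))) : WithNaO (Euc p)),
        (Sum.inl (app (CFC.sqrt (K (X' ω)))⁻¹ (Z (X' ω))) : WithNaO (Euc p)))) P P' := by
  -- The LAMN properties hold almost everywhere for the dominating measure, hence under the law of
  -- `X'`.
  have hbase : ∀ᵐ ω ∂P', (∀ δ : Euc p, q' (X' ω) δ
      = inner ℝ δ (Z (X' ω)) - (1 / 2) * inner ℝ δ (app (K (X' ω)) δ)) ∧ (K (X' ω)).PosDef := by
    have h1 := hLAMN.quadratic.and hLAMN.posDef
    have h2 := (M'.dist_absolutelyContinuous 0).ae_le h1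
    have h3 : ∀ᵐ x ∂(P'.map X'), (∀ δ : Euc p, q' x δ
      = inner ℝ δ (Z x) - (1 / 2) * inner ℝ δ (app (K x) δ)) ∧ (K x).PosDef := by
      rw [hX'.map_eq]; exact h2
    exact ae_of_ae_map hX'.aemeasurable h3
  have hjoint := (tendstoInDistribution_comp_of_ae_continuousAt measurable_newtonStats hconv
    (hbase.mono fun ω hω => continuousAt_newtonStats hω.2 hω.1 _)).congr
    (T := fun ω => (q' (X' ω), δt' ω, K (X' ω), (Sum.inl (K (X' ω)) : WithNaO (Mat p)),
        (Sum.inl (app (K (X' ω))⁻¹ (Z (X' ω))) : WithNaO (Euc p)),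
        (Sum.inl (app (CFC.sqrt (K (X' ω)))⁻¹ (Z (X' ω))) : WithNaO (Euc p))))
    (Y := fun n ω => (q n (X n ω), δt n ω, (q n (X n ω)).negHess (δt n ω),
        negHessN (q n (X n ω)) (δh n ω), δh n ω,
        appN (sqrtN (negHessN (q n (X n ω)) (δh n ω))) (δh n ω)))
    (fun n => ae_of_all _ fun ω => by simp only [newtonStats, hδh])
    (hbase.mono fun ω hω => newtonStats_of_quadratic hω.2 hω.1 _)
  have hprob := M'.isProbabilityMeasure_dist 0
  have hFZ : Measurable fun x => app (CFC.sqrt (K x))⁻¹ (Z x) :=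
    measurable_app (measurable_matrix_inv.comp (measurable_matrix_sqrt.comp hLAMN.measurable_K))
      hLAMN.measurable_Z
  have hlaw : HasLaw (fun ω => app (CFC.sqrt (K (X' ω)))⁻¹ (Z (X' ω)))
      (multivariateGaussian 0 (1 : Mat p)) P' := by
    refine ⟨hFZ.comp_aemeasurable hX'.aemeasurable, ?_⟩
    have h := map_sqrt_inv_app_eq_stdGaussian hLAMN.measurable_Z hLAMN.measurable_K
      ((M'.dist_absolutelyContinuous 0).ae_le hLAMN.posDef)
      (fun δ B hB => hLAMN.setLIntegral_exp δ hB)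
    rw [multivariateGaussian_zero_one, ← h, ← hX'.map_eq,
      AEMeasurable.map_map_of_aemeasurable hFZ.aemeasurable hX'.aemeasurable]
    rfl
  have hsnd := continuous_snd.comp (continuous_snd (X := C2 p) (Y := Euc p × Mat p ×
    WithNaO (Mat p) × WithNaO (Euc p) × WithNaO (Euc p)))
  have hsnd' := continuous_snd.comp hsnd
  have hsnd'' := continuous_snd.comp hsnd'
  have ha := hjoint.continuous_comp (continuous_fst.comp hsnd)
  have hb := hjoint.continuous_comp (continuous_fst.comp hsnd')
  have hc := hjoint.continuous_comp (continuous_fst.comp hsnd'')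
  have hd := hjoint.continuous_comp (continuous_snd.comp hsnd'')
  refine ⟨ha, hb, hc, ⟨hd.forall_aemeasurable, measurable_inl.aemeasurable, ?_⟩, hlaw, hjoint⟩
  -- In (d) the limit variable lives on the Gaussian space itself; only its law matters, and `hlaw`
  -- matches it with that of `K^{-1/2}Z`.
  convert! hd.tendsto using 1
  refine congrArg 𝓝 (Subtype.ext ?_)
  have h := AEMeasurable.map_map_of_aemeasurable
    (measurable_inl (α := Euc p) (β := Unit)).aemeasurable hlaw.aemeasurable
  rw [hlaw.map_eq] at h
  exact h
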